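/- Let $T=(V,E)$ be a finite tree with $\gamma_{\mathrm m}^{\infty}(T)=2\gamma(T)$, and let $D$ be a minimum dominating set of $T$. Then every $x\in D$ has at least two external private neighbours with respect to $D$. In particular, no leaf of $T$ (vertex of degree one) belongs to a minimum dominating set of $T$. Here a set $D\subseteq V$ is dominating if each vertex of $V\setminus D$ is adjacent to a vertex of $D$; $\gamma(T)$ is the minimum cardinality of a dominating set, and a minimum dominating set is a dominating set of cardinality $\gamma(T)$. An external private neighbour of $x\in D$ with respect to $D$ is a vertex of $V\setminus D$ that is adjacent to $x$ and to no other vertex of $D$. The number $\gamma_{\mathrm m}^{\infty}(T)$ is the minimum cardinality of an $\mathrm m$-eternal dominating set, that is, of a set $D_1\subseteq V$ from which the defender wins the following game. Initially there is one guard on each vertex of $D_1$. In round $i=1,2,\dots$ the attacker, who sees the positions of the guards, chooses a vertex $r_i\in V$; then each guard stays or moves to an adjacent vertex, all guards being allowed to move simultaneously, so that the guards occupy pairwise distinct vertices, forming a set $D_{i+1}$ with $r_i\in D_{i+1}$. The defender wins if this can be continued for ever, against every choice of attacks, with every $D_i$ $(i\ge 1)$ a dominating set. -/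

import Mathlib

namespace EternalDomination

variable {V : Type*}

/-- `D` is a dominating set of `G`: every vertex outside `D` is adjacent to a vertex of `D`. -/
def IsDominating (G : SimpleGraph V) (D : Finset V) : Prop :=
  ∀ u, u ∉ D → ∃ x ∈ D, G.Adj x u

/-- The domination number: the least cardinality of a dominating set (of a finite graph;
the whole vertex set is dominating, so the infimum is attained). -/
noncomputable def dominationNumber (G : SimpleGraph V) : ℕ :=
  sInf {k | ∃ D : Finset V, IsDominating G D ∧ D.card = k}

/-- A minimum dominating set: a dominating set of cardinality equal to the domination number. -/
def IsMinimumDominating (G : SimpleGraph V) (D : Finset V) : Prop :=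
  IsDominating G D ∧ D.card = dominationNumber G

/-- The external private neighbourhood of `x` with respect to `X` (meant for `x ∈ X`): the
vertices outside `X` that are adjacent to `x` but to no other vertex of `X`. -/
def externalPrivateNeighborhood (G : SimpleGraph V) (X : Finset V) (x : V) : Set V :=
  {v | v ∉ X ∧ G.Adj x v ∧ ∀ y ∈ X, y ≠ x → ¬ G.Adj y v}

/-- A vertex is a leaf if it has exactly one neighbour, i.e. degree one. -/
def IsLeaf (G : SimpleGraph V) (v : V) : Prop :=
  (G.neighborSet v).ncard = 1

/-- The guards, one on each vertex of `D`, can move in one step so as to occupy exactly the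
vertices of `D'`: every guard stays where it is or moves along an edge, all guards may move
at the same time, and no two guards end on the same vertex. -/
def GuardMove (G : SimpleGraph V) (D D' : Finset V) : Prop :=
  ∃ f : V → V, Set.BijOn f D D' ∧ ∀ v ∈ D, f v = v ∨ G.Adj v (f v)

/-- A winning strategy of the defender in the all-guards-move game. The strategy `σ` assigns to
every finite history of attacks (the most recent attack first) the set of vertices
occupied by the guards after that history; `σ []` is the initial placement. Every
configuration has to be dominating, and whatever vertex `r` is attacked next, the guards have
to reach the next configuration in one step and put a guard on `r`. -/
structure IsDefenderStrategy (G : SimpleGraph V) (σ : List V → Finset V) : Prop where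
  dominating : ∀ h : List V, IsDominating G (σ h)
  move : ∀ (h : List V) (r : V), GuardMove G (σ h) (σ (r :: h))
  defends : ∀ (h : List V) (r : V), r ∈ σ (r :: h)

/-- `D` is an m-eternal dominating set: the defender wins the all-guards-move game, against any
infinite sequence of attacks, when the guards are initially placed on `D`. -/
def IsMEternalDominating (G : SimpleGraph V) (D : Finset V) : Prop :=
  ∃ σ : List V → Finset V, σ [] = D ∧ IsDefenderStrategy G σ

/-- The m-eternal domination number: the least cardinality of an m-eternal dominating set (of a
finite graph; the whole vertex set is m-eternal dominating, so the infimum is attained). -/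
noncomputable def mEternalDominationNumber (G : SimpleGraph V) : ℕ :=
  sInf {k | ∃ D : Finset V, IsMEternalDominating G D ∧ D.card = k}

end EternalDomination

namespace EternalDomination

/-! If some `x ∈ D` had at most one external private neighbour, fewer than `2 * D.card` guards would
suffice. Split the graph into stars centred at `D`, giving `x` only private neighbours. The star at
`x` is then a vertex or an edge, held by one guard; any other star keeps a guard on its centre and a
second, roaming one (`IsDominating.exists_isMEternalDominating_card_lt`). A leaf has too few
neighbours to have two private ones. -/

/-- If a property of guard configurations forces domination and can be restored after every
attack, then every configuration with this property is m-eternal dominating. -/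
theorem isMEternalDominating_of_invariant {V : Type*} {G : SimpleGraph V}
    (P : Finset V → Prop) (hdom : ∀ C, P C → IsDominating G C)
    (hstep : ∀ C, P C → ∀ r, ∃ C', P C' ∧ GuardMove G C C' ∧ r ∈ C')
    {C : Finset V} (hC : P C) : IsMEternalDominating G C := by
  choose next hP hmove hmem using hstep
  -- Histories list the newest attack first, so the outermost step of `foldr` answers the latest
  -- attack.
  let τ : List V → {C // P C} := fun l =>
    l.foldr (fun r S => ⟨next S.1 S.2 r, hP S.1 S.2 r⟩) ⟨C, hC⟩
  exact ⟨fun l => (τ l).1, rfl, fun l => hdom _ (τ l).2,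
    fun l r => hmove _ (τ l).2 r, fun l r => hmem _ (τ l).2 r⟩

theorem GuardMove.refl {V : Type*} (G : SimpleGraph V) (C : Finset V) : GuardMove G C C :=
  ⟨id, Set.bijOn_id _, fun _ _ => Or.inl rfl⟩

/-- A single guard moves from `m` to the unoccupied vertex `r`. -/
theorem guardMove_insert_erase {V : Type*} [DecidableEq V] {G : SimpleGraph V} {C : Finset V}
    {m r : V} (hm : m ∈ C) (hr : r ∉ C) (hmr : G.Adj m r) :
    GuardMove G C (insert r (C.erase m)) := by
  refine ⟨fun v => if v = m then r else v, ⟨?_, ?_, ?_⟩, ?_⟩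
  · intro v hv
    simp only [Finset.coe_insert, Finset.coe_erase, Set.mem_insert_iff, Set.mem_sdiff,
      Finset.mem_coe, Set.mem_singleton_iff] at *
    grind
  · intro v hv w hw hvw
    simp only [Finset.mem_coe] at *
    grind
  · intro v hv
    simp only [Finset.coe_insert, Finset.coe_erase, Set.mem_insert_iff, Set.mem_sdiff,
      Finset.mem_coe, Set.mem_singleton_iff, Set.mem_image] at *
    rcases hv with rfl | hv
    · exact ⟨m, hm, by simp⟩
    · exact ⟨v, hv.1, by simp [hv.2]⟩
  · intro v hv
    by_cases h : v = m
    · subst h; simp [hmr]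
    · simp [h]

/-- The guard on `y` moves to the unoccupied vertex `r`, and the guard on `m` replaces it. -/
theorem guardMove_insert_erase_of_path {V : Type*} [DecidableEq V] {G : SimpleGraph V}
    {C : Finset V} {m y r : V} (hm : m ∈ C) (hy : y ∈ C) (hr : r ∉ C) (hmy : G.Adj m y)
    (hyr : G.Adj y r) : GuardMove G C (insert r (C.erase m)) := by
  have hne : m ≠ y := hmy.ne
  refine ⟨fun v => if v = y then r else if v = m then y else v, ⟨?_, ?_, ?_⟩, ?_⟩
  · intro v hv
    simp only [Finset.coe_insert, Finset.coe_erase, Set.mem_insert_iff, Set.mem_sdiff,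
      Finset.mem_coe, Set.mem_singleton_iff] at *
    grind
  · intro v hv w hw hvw
    simp only [Finset.mem_coe] at *
    grind
  · intro v hv
    simp only [Finset.coe_insert, Finset.coe_erase, Set.mem_insert_iff, Set.mem_sdiff,
      Finset.mem_coe, Set.mem_singleton_iff, Set.mem_image] at *
    rcases hv with rfl | hv
    · exact ⟨y, hy, by simp⟩
    · by_cases h : v = y
      · exact ⟨m, hm, by simp [hne, h]⟩
      · exact ⟨v, hv.1, by simp [hv.2, h]⟩
  · intro v hv
    by_cases h : v = y
    · subst h; simp [hyr]
    · by_cases h' : v = m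
      · subst h'; simp [hne, hmy]
      · simp [h, h']

/-- A partition of the vertex set into stars centred at the vertices of a dominating set, in
which the star at `x` consists of `x` and its external private neighbours. -/
theorem IsDominating.exists_starPartition {V : Type*} {G : SimpleGraph V} {D : Finset V}
    (hD : IsDominating G D) (x : V) :
    ∃ p : V → V, (∀ u, p u ∈ D) ∧ (∀ y ∈ D, p y = y) ∧ (∀ u, u ∉ D → G.Adj (p u) u) ∧
      ∀ u, u ∉ D → p u = x → u ∈ externalPrivateNeighborhood G D x := by
  have key : ∀ u, ∃ y ∈ D, (u ∈ D → y = u) ∧ (u ∉ D → G.Adj y u) ∧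
      (u ∉ D → y = x → u ∈ externalPrivateNeighborhood G D x) := by
    intro u
    by_cases hu : u ∈ D
    · exact ⟨u, hu, fun _ => rfl, fun h => absurd hu h, fun h => absurd hu h⟩
    -- Any centre other than `x` is preferred, so `x` receives only vertices that no other centre
    -- dominates.
    · by_cases h : ∃ y ∈ D, y ≠ x ∧ G.Adj y u
      · obtain ⟨y, hy, hyx, hyu⟩ := h
        exact ⟨y, hy, fun h => absurd h hu, fun _ => hyu, fun _ h => absurd h hyx⟩
      · push Not at h
        obtain ⟨y, hy, hyu⟩ := hD u hu
        refine ⟨y, hy, fun h => absurd h hu, fun _ => hyu, ?_⟩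
        rintro _ rfl
        exact ⟨hu, hyu, h⟩
  choose p h₁ h₂ h₃ h₄ using key
  exact ⟨p, h₁, h₂, h₃, h₄⟩

/-- If a vertex `x` of a dominating set `D` has at most one external private neighbour, then
`2 * D.card - 1` guards suffice: two on every star of a star partition, but only one on the
star at `x`, which has at most two vertices. -/
theorem IsDominating.exists_isMEternalDominating_card_lt {V : Type*} {G : SimpleGraph V}
    {D : Finset V} (hD : IsDominating G D) {x : V} (hx : x ∈ D)
    (hpriv : (externalPrivateNeighborhood G D x).Subsingleton) :
    ∃ C : Finset V, IsMEternalDominating G C ∧ C.card < 2 * D.card := by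
  classical
  obtain ⟨p, hpD, hpc, hadj, hpx⟩ := hD.exists_starPartition x
  -- The star at `x` is a clique, so a guard anywhere in it dominates it and can reach any attacked
  -- vertex of it.
  have hadjx : ∀ u v, p u = x → p v = x → u ≠ v → G.Adj u v := by
    intro u v hu hv huv
    by_cases huD : u ∈ D
    · have hux : u = x := (hpc u huD).symm.trans hu
      have hvD : v ∉ D := fun h => huv (hux.trans (((hpc v h).symm.trans hv)).symm)
      have := hadj v hvD
      rwa [hv, ← hux] at this
    · by_cases hvD : v ∈ D
      · have hvx : v = x := (hpc v hvD).symm.trans hv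
        have := hadj u huD
        rw [hu, ← hvx] at this
        exact this.symm
      · exact absurd (hpriv (hpx u huD hu) (hpx v hvD hv)) huv
  have hadjc : ∀ u, u ≠ p u → G.Adj (p u) u := fun u hu =>
    hadj u fun h => hu (hpc u h).symm
  -- Here `m` is the roaming guard of the star at `y`. For `y ≠ x` it may coincide with the centre
  -- guard only if the star is a single vertex.
  let P : Finset V → Prop := fun C => D.erase x ⊆ C ∧
    ∀ y ∈ D, ∃ m ∈ C, p m = y ∧ (y ≠ x → m = y → ∀ u, p u = y → u = y)
  have hdom : ∀ C, P C → IsDominating G C := by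
    rintro C ⟨hDC, hC⟩ u hu
    by_cases hux : p u = x
    · obtain ⟨m, hm, hmx, -⟩ := hC x hx
      exact ⟨m, hm, hadjx m u hmx hux fun h => hu (h ▸ hm)⟩
    · have hpu : p u ∈ C := hDC (Finset.mem_erase.2 ⟨hux, hpD u⟩)
      exact ⟨p u, hpu, hadjc u fun h => hu (h ▸ hpu)⟩
  have hstep : ∀ C, P C → ∀ r, ∃ C', P C' ∧ GuardMove G C C' ∧ r ∈ C' := by
    rintro C ⟨hDC, hC⟩ r
    by_cases hr : r ∈ C
    · exact ⟨C, ⟨hDC, hC⟩, GuardMove.refl G C, hr⟩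
    obtain ⟨m, hm, hmp, hmy⟩ := hC (p r) (hpD r)
    -- Centres other than `x` are occupied, so an unguarded `r` in such a star is not its centre;
    -- the star is thus nontrivial and its roaming guard is off the centre.
    have hrp : p r ≠ x → r ≠ p r := fun h h' =>
      hr (hDC (Finset.mem_erase.2 ⟨h' ▸ h, h' ▸ hpD r⟩))
    have hmne : p r ≠ x → m ≠ p r := fun h h' => hrp h (hmy h h' r rfl)
    refine ⟨insert r (C.erase m), ⟨?_, ?_⟩, ?_, Finset.mem_insert_self _ _⟩
    · intro d hd
      refine Finset.mem_insert_of_mem (Finset.mem_erase.2 ⟨?_, hDC hd⟩)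
      rintro rfl
      obtain ⟨hdx, hdD⟩ := Finset.mem_erase.1 hd
      have hdr : d = p r := (hpc d hdD).symm.trans hmp
      exact hmne (hdr ▸ hdx) hdr
    · intro y hy
      by_cases hyr : p r = y
      · subst hyr
        exact ⟨r, Finset.mem_insert_self _ _, rfl, fun h h' => absurd h' (hrp h)⟩
      · obtain ⟨n, hn, hny, hn'⟩ := hC y hy
        refine ⟨n, Finset.mem_insert_of_mem (Finset.mem_erase.2 ⟨?_, hn⟩), hny, hn'⟩
        rintro rfl
        exact hyr (hmp.symm.trans hny)
    · by_cases hrx : p r = x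
      · exact guardMove_insert_erase hm hr
          (hadjx m r (hmp.trans hrx) hrx fun h => hr (h ▸ hm))
      · have hmadj : G.Adj (p r) m := by
          have := hadjc m (by rw [hmp]; exact hmne hrx)
          rwa [hmp] at this
        exact guardMove_insert_erase_of_path hm
          (hDC (Finset.mem_erase.2 ⟨hrx, hpD r⟩)) hr hmadj.symm (hadjc r (hrp hrx))
  -- Initial roaming guards: a non-central vertex of the star if there is one, otherwise the centre.
  have hs : ∀ y, ∃ m, y ∈ D → p m = y ∧ (m = y → ∀ u, p u = y → u = y) := by
    intro y
    by_cases h : ∃ u, p u = y ∧ u ≠ y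
    · obtain ⟨u, hu, huy⟩ := h
      exact ⟨u, fun _ => ⟨hu, fun h => absurd h huy⟩⟩
    · push Not at h
      exact ⟨y, fun hy => ⟨hpc y hy, fun _ => h⟩⟩
  choose s hs using hs
  refine ⟨D.erase x ∪ D.image s,
    isMEternalDominating_of_invariant P hdom hstep ⟨Finset.subset_union_left, ?_⟩, ?_⟩
  · intro y hy
    exact ⟨s y, Finset.mem_union_right _ (Finset.mem_image_of_mem s hy), (hs y hy).1,
      fun _ => (hs y hy).2⟩
  · have h₁ := Finset.card_union_le (D.erase x) (D.image s)
    have h₂ : (D.image s).card ≤ D.card := Finset.card_image_le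
    have h₃ := Finset.card_erase_lt_of_mem hx
    omega

end EternalDomination

theorem proposition5p3 {V : Type*} [Finite V] (T : SimpleGraph V) (hT : T.IsTree)
    (h : EternalDomination.mEternalDominationNumber T =
      2 * EternalDomination.dominationNumber T)
    (D : Finset V) (hD : EternalDomination.IsMinimumDominating T D) :
    (∀ x ∈ D, 2 ≤ (EternalDomination.externalPrivateNeighborhood T D x).ncard) ∧
    (∀ v : V, EternalDomination.IsLeaf T v → v ∉ D) := by
  have main : ∀ x ∈ D, 2 ≤ (EternalDomination.externalPrivateNeighborhood T D x).ncard := by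
    intro x hx
    by_contra hlt
    have hsub : (EternalDomination.externalPrivateNeighborhood T D x).Subsingleton :=
      fun a ha b hb => (Set.ncard_le_one (Set.toFinite _)).1 (by omega) a ha b hb
    obtain ⟨C, hC, hcard⟩ := hD.1.exists_isMEternalDominating_card_lt hx hsub
    have hle : EternalDomination.mEternalDominationNumber T ≤ C.card :=
      Nat.sInf_le ⟨C, hC, rfl⟩
    rw [h, ← hD.2] at hle
    omega
  refine ⟨main, fun v hv hvD => ?_⟩
  have h₁ := main v hvD
  have h₂ : (EternalDomination.externalPrivateNeighborhood T D v).ncard ≤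
      (T.neighborSet v).ncard :=
    Set.ncard_le_ncard (fun _ hu => hu.2.1) (Set.toFinite _)
  rw [hv] at h₂
  omega
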